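/- Let $(\mathcal A,G,\alpha)$ be a free C$^*$-dynamical system. That is, $\mathcal A$ is a unital C$^*$-algebra, $G$ is a compact group acting on $\mathcal A$ by $^*$-automorphisms $\alpha_g$ such that $(g,x)\mapsto\alpha_g(x)$ is continuous on $G\times\mathcal A$, and the Ellwood map $$\mathcal A\otimes_{\mathrm{alg}}\mathcal A\to C(G,\mathcal A),\qquad x\otimes y\mapsto\bigl(g\mapsto x\,\alpha_g(y)\bigr)$$ has dense range with respect to the supremum norm. Let $\mathcal B:=\mathcal A^G=\{x\in\mathcal A:\alpha_g(x)=x\ \forall g\in G\}$ be the fixed point algebra. A covariant representation of $(\mathcal A,G,\alpha)$ on a complex Hilbert space $\mathfrak H$ is a pair $(\pi,u)$ of a unital $^*$-representation $\pi$ of $\mathcal A$ and a strongly continuous unitary representation $u$ of $G$ on $\mathfrak H$ with $u_g\pi(x)u_g^*=\pi(\alpha_g(x))$ for all $g\in G$ and $x\in\mathcal A$. It is faithful if $\pi$ is injective. Its trivial isotypic component $\mathfrak H(1):=\{\xi\in\mathfrak H:u_g\xi=\xi\ \forall g\in G\}$ is a representation space of $\mathcal B$ by restriction of $\pi$. Two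 covariant representations $(\pi,u)$ on $\mathfrak H$ and $(\pi',u')$ on $\mathfrak H'$ are unitarily equivalent if there is a unitary $U:\mathfrak H\to\mathfrak H'$ with $U\pi(x)=\pi'(x)U$ and $Uu_g=u'_gU$ for all $x\in\mathcal A$ and $g\in G$. Let $(\pi_{\mathcal B},\mathfrak H_{\mathcal B})$ be a unital $^*$-representation of $\mathcal B$ on a complex Hilbert space. Then all faithful covariant representations of $(\mathcal A,G,\alpha)$ whose trivial isotypic component is, as a representation space of $\mathcal B$, unitarily equivalent to $(\pi_{\mathcal B},\mathfrak H_{\mathcal B})$ are unitarily equivalent to one another. -/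

import Mathlib

open scoped TensorProduct

/-- A C*-dynamical system `(A, G, α)`: a group `G` (compact, in the results below) acting on a unital
C*-algebra `A` by *-automorphisms `α g` such that `(g, x) ↦ α g x` is jointly continuous. -/
structure CStarDynamicalSystem (A G : Type*) [CStarAlgebra A] [Group G] [TopologicalSpace G] where
  /-- the action by *-automorphisms -/
  α : G →* (A ≃⋆ₐ[ℂ] A)
  continuous_action : Continuous fun q : G × A => α q.1 q.2

namespace CStarDynamicalSystem

variable {A G : Type*} [CStarAlgebra A] [Group G] [TopologicalSpace G]

lemma continuous_orbit (S : CStarDynamicalSystem A G) (y : A) : Continuous fun g => S.α g y :=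
  S.continuous_action.comp (by fun_prop : Continuous fun g : G => (g, y))

/-- The Ellwood map `A ⊗ A → C(G, A)` on the algebraic tensor product,
`x ⊗ y ↦ (g ↦ x * α g y)`. -/
noncomputable def ellwoodMap (S : CStarDynamicalSystem A G) : A ⊗[ℂ] A →ₗ[ℂ] C(G, A) :=
  TensorProduct.lift <| LinearMap.mk₂ ℂ
    (fun x y => ⟨fun g => x * S.α g y, continuous_const.mul (S.continuous_orbit y)⟩)
    (fun x x' y => by ext g; simp [add_mul])
    (fun c x y => by ext g; simp)
    (fun x y y' => by ext g; simp [mul_add])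
    (fun c x y => by ext g; simp)

/-- The system is free (in the sense of Ellwood) if its Ellwood map has dense range. For compact
`G` the topology of `C(G, A)` is the one of the supremum norm. -/
def IsFree (S : CStarDynamicalSystem A G) : Prop := DenseRange S.ellwoodMap

/-- The fixed point algebra `B = A^G`. -/
def fixedPointAlgebra (S : CStarDynamicalSystem A G) : StarSubalgebra ℂ A where
  carrier := {x | ∀ g, S.α g x = x}
  mul_mem' := fun hx hy g => by rw [map_mul, hx g, hy g]
  one_mem' := fun g => map_one _
  add_mem' := fun hx hy g => by rw [map_add, hx g, hy g]
  zero_mem' := fun g => map_zero _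
  algebraMap_mem' := fun c g => by
    rw [Algebra.algebraMap_eq_smul_one, map_smul, map_one]
  star_mem' := fun hx g => by rw [map_star, hx g]

/-- A covariant representation `(π, u)` of `(A, G, α)` on a Hilbert space `H`: a unital
*-representation `π` of `A` and a strongly continuous unitary representation `u` of `G` with
`u g * π x * (u g)* = π (α g x)`. -/
structure CovariantRep (S : CStarDynamicalSystem A G)
    (H : Type*) [NormedAddCommGroup H] [InnerProductSpace ℂ H] [CompleteSpace H] where
  /-- the representation of the algebra -/
  π : A →⋆ₐ[ℂ] (H →L[ℂ] H)
  /-- the representation of the group -/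
  u : G →* unitary (H →L[ℂ] H)
  continuous_u : ∀ ξ : H, Continuous fun g => (u g : H →L[ℂ] H) ξ
  covariant : ∀ (g : G) (x : A),
    (u g : H →L[ℂ] H) * π x * star (u g : H →L[ℂ] H) = π (S.α g x)

end CStarDynamicalSystem

/-- Unitary equivalence of two *-representations of a complex unital *-algebra. -/
def StarRepUnitarilyEquivalent {C : Type*} [Ring C] [StarRing C] [Algebra ℂ C]
    {H₁ : Type*} [NormedAddCommGroup H₁] [InnerProductSpace ℂ H₁] [CompleteSpace H₁]
    {H₂ : Type*} [NormedAddCommGroup H₂] [InnerProductSpace ℂ H₂] [CompleteSpace H₂]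
    (π₁ : C →⋆ₐ[ℂ] (H₁ →L[ℂ] H₁)) (π₂ : C →⋆ₐ[ℂ] (H₂ →L[ℂ] H₂)) : Prop :=
  ∃ U : H₁ ≃ₗᵢ[ℂ] H₂, ∀ (c : C) (ξ : H₁), U (π₁ c ξ) = π₂ c (U ξ)

namespace CStarDynamicalSystem.CovariantRep

variable {A G : Type*} [CStarAlgebra A] [Group G] [TopologicalSpace G]
  {S : CStarDynamicalSystem A G}
  {H : Type*} [NormedAddCommGroup H] [InnerProductSpace ℂ H] [CompleteSpace H]
  {H₁ : Type*} [NormedAddCommGroup H₁] [InnerProductSpace ℂ H₁] [CompleteSpace H₁]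
  {H₂ : Type*} [NormedAddCommGroup H₂] [InnerProductSpace ℂ H₂] [CompleteSpace H₂]

/-- A covariant representation is faithful if its algebra representation is injective. -/
def IsFaithful (ρ : S.CovariantRep H) : Prop := Function.Injective ρ.π

/-- Unitary equivalence of covariant representations: a unitary that intertwines both the algebra
and the group representations. -/
def UnitarilyEquivalent (ρ₁ : S.CovariantRep H₁) (ρ₂ : S.CovariantRep H₂) : Prop :=
  ∃ U : H₁ ≃ₗᵢ[ℂ] H₂,
    (∀ (x : A) (ξ : H₁), U (ρ₁.π x ξ) = ρ₂.π x (U ξ)) ∧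
    ∀ (g : G) (ξ : H₁), U ((ρ₁.u g : H₁ →L[ℂ] H₁) ξ) = (ρ₂.u g : H₂ →L[ℂ] H₂) (U ξ)

/-- The isotypic component `H(1)` of `H` for the trivial representation of `G`, i.e. the space of
`G`-fixed vectors. -/
def trivialIsotypic (ρ : S.CovariantRep H) : Submodule ℂ H where
  carrier := {ξ | ∀ g, (ρ.u g : H →L[ℂ] H) ξ = ξ}
  add_mem' := fun hξ hη g => by rw [map_add, hξ g, hη g]
  zero_mem' := fun g => map_zero _
  smul_mem' := fun c ξ hξ g => by rw [map_smul, hξ g]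

lemma isClosed_trivialIsotypic (ρ : S.CovariantRep H) :
    IsClosed (ρ.trivialIsotypic : Set H) := by
  have : (ρ.trivialIsotypic : Set H) = ⋂ g, {ξ | (ρ.u g : H →L[ℂ] H) ξ = ξ} := by
    ext ξ; simp [trivialIsotypic]
  rw [this]
  exact isClosed_iInter fun g => isClosed_eq (ρ.u g : H →L[ℂ] H).continuous continuous_id

instance (ρ : S.CovariantRep H) : CompleteSpace ρ.trivialIsotypic :=
  ρ.isClosed_trivialIsotypic.completeSpace_coe

lemma π_mem_trivialIsotypic (ρ : S.CovariantRep H) (b : S.fixedPointAlgebra)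
    (ξ : H) (hξ : ξ ∈ ρ.trivialIsotypic) : ρ.π b ξ ∈ ρ.trivialIsotypic := by
  intro g
  have h1 := ρ.covariant g b
  rw [b.2 g] at h1
  have h2 : (ρ.u g : H →L[ℂ] H) * ρ.π b = ρ.π b * (ρ.u g : H →L[ℂ] H) := by
    conv_rhs => rw [← h1]
    rw [mul_assoc _ (star _) _, Unitary.coe_star_mul_self, mul_one]
  have h3 := congrArg (fun T : H →L[ℂ] H => T ξ) h2
  simpa [hξ g] using h3

/-- The representation of the fixed point algebra `B` on the trivial isotypic component `H(1)`,
obtained by restricting the operators `π b`. -/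
noncomputable def trivialIsotypicRep (ρ : S.CovariantRep H) :
    S.fixedPointAlgebra →⋆ₐ[ℂ] (ρ.trivialIsotypic →L[ℂ] ρ.trivialIsotypic) where
  toFun b := (ρ.π (b : A)).restrict (ρ.π_mem_trivialIsotypic b)
  map_one' := by ext ξ; simp
  map_mul' := fun b c => by ext ξ; simp
  map_zero' := by ext ξ; simp
  map_add' := fun b c => by ext ξ; simp
  commutes' := fun c => by ext ξ; simp [Algebra.algebraMap_eq_smul_one]
  map_star' := fun b => by
    rw [ContinuousLinearMap.star_eq_adjoint, ContinuousLinearMap.eq_adjoint_iff]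
    intro ξ η
    change inner ℂ (ρ.π (star (b : A)) ξ) (η : H) = inner ℂ (ξ : H) (ρ.π (b : A) η)
    rw [map_star, ContinuousLinearMap.star_eq_adjoint, ContinuousLinearMap.adjoint_inner_left]

end CStarDynamicalSystem.CovariantRep

/-!
A covariant representation of a free system is determined by the representation of the fixed point
algebra `B` on its `G`-fixed vectors `H(1)`, for two reasons.

* The vectors `π x ξ` with `x ∈ A` and `ξ ∈ H(1)` span a dense subspace of `H`
  (`CovariantRep.denseRange_inducedMap`). Let `ξ` be orthogonal to all of them. The functional
  `F ↦ ∫ ⟪ξ, π (F g) (u g ξ)⟫ dg` on `C(G, A)` is continuous. On `g ↦ x * α g y` it takes the value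
  `⟪ξ, π x (∫ u g (π y ξ) dg)⟫`, which is zero because the averaged vector is fixed by `G`. So it
  vanishes on the range of the Ellwood map, hence, by freeness, everywhere. Its value at
  `F g = ⟪u g ξ, ξ⟫ • 1` is `∫ |⟪ξ, u g ξ⟫|² dg`, and a continuous nonnegative function with
  vanishing Haar integral is zero; at `g = 1` this reads `‖ξ‖ ^ 4 = 0`.
* The inner products of these vectors depend only on the representation of `B` on `H(1)`:
  `⟪π x ξ, π y η⟫ = ⟪ξ, π (∫ α g (star x * y) dg) η⟫`, where the averaged element lies in `B`
  (`CovariantRep.inner_π_apply_π_apply`).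

A unitary `W` between the two spaces `H(1)` that intertwines the representations of `B` therefore
extends to the unitary `π₁ x ξ ↦ π₂ x (W ξ)`, and this one intertwines `π₁` with `π₂` and `u₁` with
`u₂`.
-/

open MeasureTheory Measure
open scoped InnerProductSpace

/-! ### Averaging over a compact group -/

section Averaging

variable {G : Type*} [Group G] [TopologicalSpace G] [IsTopologicalGroup G] [CompactSpace G]
  [MeasurableSpace G] [BorelSpace G]

lemma Continuous.integrable_of_compactSpace {X E : Type*} [TopologicalSpace X] [CompactSpace X]
    [MeasurableSpace X] [BorelSpace X] [NormedAddCommGroup E] (μ : Measure X)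
    [IsFiniteMeasureOnCompacts μ] {f : X → E} (hf : Continuous f) : Integrable f μ :=
  hf.integrable_of_hasCompactSupport (HasCompactSupport.of_compactSpace f)

/-- The integral of an equivariant function on a compact group is a fixed point. -/
lemma ContinuousLinearMap.map_integral_eq_self_of_equivariant {E : Type*} [NormedAddCommGroup E]
    [NormedSpace ℂ E] [CompleteSpace E] (μ : Measure G) [IsHaarMeasure μ] {f : G → E}
    (hf : Continuous f) (h : G) (L : E →L[ℂ] E) (hL : ∀ g, L (f g) = f (h * g)) :
    L (∫ g, f g ∂μ) = ∫ g, f g ∂μ := by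
  rw [← L.integral_comp_comm (hf.integrable_of_compactSpace μ)]
  simp_rw [hL]
  exact integral_mul_left_eq_self f h

variable (G) in
lemma isProbabilityMeasure_haarMeasure_top :
    IsProbabilityMeasure (haarMeasure (⊤ : TopologicalSpace.PositiveCompacts G)) :=
  ⟨by simpa using haarMeasure_self (K₀ := (⊤ : TopologicalSpace.PositiveCompacts G))⟩

lemma CStarDynamicalSystem.integral_orbit_mem_fixedPointAlgebra {A : Type*} [CStarAlgebra A]
    (S : CStarDynamicalSystem A G) (μ : Measure G) [IsHaarMeasure μ] (a : A) :
    ∫ g, S.α g a ∂μ ∈ S.fixedPointAlgebra := fun h =>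
  ContinuousLinearMap.map_integral_eq_self_of_equivariant μ (S.continuous_orbit a) h
    ⟨((S.α h : A ≃⋆ₐ[ℂ] A) : A →ₗ[ℂ] A), (StarAlgEquiv.isometry (S.α h)).continuous⟩
    fun g => by rw [map_mul]; rfl

end Averaging

namespace CStarDynamicalSystem.CovariantRep

variable {A G : Type*} [CStarAlgebra A] [Group G] [TopologicalSpace G]
  {S : CStarDynamicalSystem A G}
  {H : Type*} [NormedAddCommGroup H] [InnerProductSpace ℂ H] [CompleteSpace H]
  {H₁ : Type*} [NormedAddCommGroup H₁] [InnerProductSpace ℂ H₁] [CompleteSpace H₁]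
  {H₂ : Type*} [NormedAddCommGroup H₂] [InnerProductSpace ℂ H₂] [CompleteSpace H₂]

/-! ### Covariance relations and the map induced from the fixed vectors -/

lemma π_mul_apply (ρ : S.CovariantRep H) (x y : A) (ξ : H) :
    ρ.π (x * y) ξ = ρ.π x (ρ.π y ξ) := by
  simp

lemma u_apply_π_apply (ρ : S.CovariantRep H) (g : G) (x : A) (ξ : H) :
    (ρ.u g : H →L[ℂ] H) (ρ.π x ξ) = ρ.π (S.α g x) ((ρ.u g : H →L[ℂ] H) ξ) := by
  have h : (ρ.u g : H →L[ℂ] H) * ρ.π x = ρ.π (S.α g x) * (ρ.u g : H →L[ℂ] H) := by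
    rw [← ρ.covariant g x, mul_assoc _ (star _) _, Unitary.coe_star_mul_self, mul_one]
  exact congrArg (fun T : H →L[ℂ] H => T ξ) h

lemma inner_u_apply_u_apply (ρ : S.CovariantRep H) (g : G) (ξ η : H) :
    ⟪(ρ.u g : H →L[ℂ] H) ξ, (ρ.u g : H →L[ℂ] H) η⟫_ℂ = ⟪ξ, η⟫_ℂ := by
  rw [← ContinuousLinearMap.adjoint_inner_right, ← ContinuousLinearMap.star_eq_adjoint,
    ← mul_apply_eq_comp, Unitary.coe_star_mul_self, one_apply_eq_self]

lemma norm_u_apply (ρ : S.CovariantRep H) (g : G) (ξ : H) :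
    ‖(ρ.u g : H →L[ℂ] H) ξ‖ = ‖ξ‖ := by
  rw [norm_eq_sqrt_re_inner (𝕜 := ℂ), ρ.inner_u_apply_u_apply, ← norm_eq_sqrt_re_inner]

lemma inner_π_apply_left (ρ : S.CovariantRep H) (x : A) (ξ η : H) :
    ⟪ρ.π x ξ, η⟫_ℂ = ⟪ξ, ρ.π (star x) η⟫_ℂ := by
  rw [map_star, ContinuousLinearMap.star_eq_adjoint, ContinuousLinearMap.adjoint_inner_right]

lemma continuous_π (ρ : S.CovariantRep H) : Continuous ρ.π :=
  AddMonoidHomClass.continuous_of_bound ρ.π 1 fun x => by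
    simpa only [one_mul] using NonUnitalStarAlgHom.norm_apply_le ρ.π x

lemma continuous_π_apply_u_apply (ρ : S.CovariantRep H) (F : C(G, A)) (ξ : H) :
    Continuous fun g => ρ.π (F g) ((ρ.u g : H →L[ℂ] H) ξ) :=
  (ρ.continuous_π.comp F.continuous).clm_apply (ρ.continuous_u ξ)

/-- The linear map `A ⊗ H(1) → H`, `x ⊗ ξ ↦ π x ξ`, on the algebraic tensor product. -/
noncomputable def inducedMap (ρ : S.CovariantRep H) : A ⊗[ℂ] ρ.trivialIsotypic →ₗ[ℂ] H :=
  TensorProduct.lift <| LinearMap.mk₂ ℂ (fun x ξ => ρ.π x (ξ : H))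
    (fun x x' ξ => by simp)
    (fun c x ξ => by simp)
    (fun x ξ ξ' => by simp)
    (fun c x ξ => by simp)

@[simp]
lemma inducedMap_tmul (ρ : S.CovariantRep H) (x : A) (ξ : ρ.trivialIsotypic) :
    ρ.inducedMap (x ⊗ₜ ξ) = ρ.π x ξ := rfl

lemma inducedMap_rTensor_mulLeft (ρ : S.CovariantRep H) (x : A) (t : A ⊗[ℂ] ρ.trivialIsotypic) :
    ρ.inducedMap ((LinearMap.mulLeft ℂ x).rTensor _ t) = ρ.π x (ρ.inducedMap t) := by
  induction t with
  | zero => simp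
  | tmul y ξ => simp
  | add s t hs ht => rw [map_add, map_add, map_add, map_add, hs, ht]

lemma inducedMap_rTensor_α (ρ : S.CovariantRep H) (g : G) (t : A ⊗[ℂ] ρ.trivialIsotypic) :
    ρ.inducedMap (((S.α g : A ≃⋆ₐ[ℂ] A) : A →ₗ[ℂ] A).rTensor _ t) =
      (ρ.u g : H →L[ℂ] H) (ρ.inducedMap t) := by
  induction t with
  | zero => simp
  | tmul y ξ =>
    have h : (ρ.u g : H →L[ℂ] H) ξ = ξ := ξ.2 g
    simp [ρ.u_apply_π_apply, h]
  | add s t hs ht => rw [map_add, map_add, map_add, map_add, hs, ht]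

/-! ### Averages in a covariant representation -/

variable [CompactSpace G]

section Haar

variable [MeasurableSpace G] [BorelSpace G] (μ : Measure G) [IsHaarMeasure μ]

lemma integral_u_apply_mem_trivialIsotypic [IsTopologicalGroup G] (ρ : S.CovariantRep H) (ζ : H) :
    ∫ g, (ρ.u g : H →L[ℂ] H) ζ ∂μ ∈ ρ.trivialIsotypic := fun h =>
  ContinuousLinearMap.map_integral_eq_self_of_equivariant μ (ρ.continuous_u ζ) h _
    fun g => by simp [map_mul]

/-- The inner products of the vectors `π x ξ` with `ξ ∈ H(1)` are determined by the action of the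
fixed point algebra on `H(1)`, through the conditional expectation `a ↦ ∫ α g a dg`. -/
lemma inner_π_apply_π_apply [IsTopologicalGroup G] [IsProbabilityMeasure μ]
    (ρ : S.CovariantRep H) (x y : A) (ξ η : ρ.trivialIsotypic) :
    ⟪ρ.π x ξ, ρ.π y η⟫_ℂ =
      ⟪ξ, ρ.trivialIsotypicRep
        ⟨∫ g, S.α g (star x * y) ∂μ, S.integral_orbit_mem_fixedPointAlgebra μ _⟩ η⟫_ℂ := by
  have hfix : ∀ (ζ : ρ.trivialIsotypic) (g : G), (ρ.u g : H →L[ℂ] H) ζ = ζ := fun ζ => ζ.2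
  have hint : Integrable (fun g => S.α g (star x * y)) μ :=
    (S.continuous_orbit _).integrable_of_compactSpace μ
  -- the continuous functional through which the averaged element is evaluated
  let L : A →L[ℂ] ℂ := innerSL ℂ (ξ : H) ∘L ContinuousLinearMap.apply ℂ H (η : H) ∘L
    ⟨(ρ.π : A →ₗ[ℂ] H →L[ℂ] H), ρ.continuous_π⟩
  have hL : ∀ a, L a = ⟪(ξ : H), ρ.π a η⟫_ℂ := fun a => rfl
  have hconst : ∀ g, L (S.α g (star x * y)) = ⟪ρ.π x ξ, ρ.π y η⟫_ℂ := fun g => by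
    calc L (S.α g (star x * y))
        = ⟪(ρ.u g : H →L[ℂ] H) ξ, (ρ.u g : H →L[ℂ] H) (ρ.π (star x * y) η)⟫_ℂ := by
          rw [hL, ρ.u_apply_π_apply, hfix, hfix]
      _ = ⟪ρ.π x ξ, ρ.π y η⟫_ℂ := by
          rw [ρ.inner_u_apply_u_apply, ρ.π_mul_apply, ← ρ.inner_π_apply_left]
  calc ⟪ρ.π x ξ, ρ.π y η⟫_ℂ = ∫ g, L (S.α g (star x * y)) ∂μ := by
          simp_rw [hconst, integral_const, probReal_univ, one_smul]
    _ = L (∫ g, S.α g (star x * y) ∂μ) := L.integral_comp_comm hint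

/-! ### Freeness implies that `π(A) H(1)` spans a dense subspace -/

/-- The continuous functional `F ↦ ∫ ⟪ξ, π (F g) (u g ξ)⟫ dg` on `C(G, A)`. -/
noncomputable def coefficientFunctional (ρ : S.CovariantRep H) (ξ : H) : C(G, A) →L[ℂ] ℂ :=
  LinearMap.mkContinuous
    { toFun := fun F => ∫ g, ⟪ξ, ρ.π (F g) ((ρ.u g : H →L[ℂ] H) ξ)⟫_ℂ ∂μ
      map_add' := fun F F' => by
        have h : ∀ F : C(G, A),
            Integrable (fun g => ⟪ξ, ρ.π (F g) ((ρ.u g : H →L[ℂ] H) ξ)⟫_ℂ) μ := fun F =>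
          (continuous_const.inner (ρ.continuous_π_apply_u_apply F ξ)).integrable_of_compactSpace μ
        simp only [ContinuousMap.add_apply, map_add, _root_.add_apply, inner_add_right]
        exact integral_add (h F) (h F')
      map_smul' := fun c F => by
        simp only [ContinuousMap.smul_apply, map_smul, _root_.smul_apply,
          inner_smul_right, RingHom.id_apply, smul_eq_mul]
        exact integral_const_mul c _ }
    (‖ξ‖ * ‖ξ‖ * μ.real Set.univ) fun F => by
      refine (norm_integral_le_of_norm_le_const (C := ‖ξ‖ * (‖F‖ * ‖ξ‖))
        (Filter.Eventually.of_forall fun g => ?_)).trans_eq (by ring)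
      calc ‖⟪ξ, ρ.π (F g) ((ρ.u g : H →L[ℂ] H) ξ)⟫_ℂ‖
          ≤ ‖ξ‖ * ‖ρ.π (F g) ((ρ.u g : H →L[ℂ] H) ξ)‖ := norm_inner_le_norm _ _
        _ ≤ ‖ξ‖ * (‖ρ.π (F g)‖ * ‖(ρ.u g : H →L[ℂ] H) ξ‖) := by
            gcongr; exact ContinuousLinearMap.le_opNorm _ _
        _ ≤ ‖ξ‖ * (‖F‖ * ‖ξ‖) := by
            rw [ρ.norm_u_apply]
            gcongr
            exact (NonUnitalStarAlgHom.norm_apply_le ρ.π (F g)).trans (F.norm_coe_le_norm g)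

lemma coefficientFunctional_apply (ρ : S.CovariantRep H) (ξ : H) (F : C(G, A)) :
    ρ.coefficientFunctional μ ξ F = ∫ g, ⟪ξ, ρ.π (F g) ((ρ.u g : H →L[ℂ] H) ξ)⟫_ℂ ∂μ := rfl

lemma coefficientFunctional_ellwoodMap_tmul (ρ : S.CovariantRep H) (ξ : H) (x y : A) :
    ρ.coefficientFunctional μ ξ (S.ellwoodMap (x ⊗ₜ y)) =
      ⟪ξ, ρ.π x (∫ g, (ρ.u g : H →L[ℂ] H) (ρ.π y ξ) ∂μ)⟫_ℂ := by
  have hint : Integrable (fun g => (ρ.u g : H →L[ℂ] H) (ρ.π y ξ)) μ :=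
    (ρ.continuous_u _).integrable_of_compactSpace μ
  have h : ∀ g, (S.ellwoodMap (x ⊗ₜ y)) g = x * S.α g y := fun g => rfl
  simp_rw [coefficientFunctional_apply, h, ρ.π_mul_apply, ← ρ.u_apply_π_apply]
  exact (innerSL ℂ ξ ∘L ρ.π x).integral_comp_comm hint

end Haar

variable [IsTopologicalGroup G]

/-- For a free system, `π(A) H(1)` spans a dense subspace of `H`. -/
theorem denseRange_inducedMap (hS : S.IsFree) (ρ : S.CovariantRep H) :
    DenseRange ρ.inducedMap := by
  let _ : MeasurableSpace G := borel G
  have : BorelSpace G := ⟨rfl⟩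
  let μ : Measure G := haarMeasure ⊤
  change Dense ((LinearMap.range ρ.inducedMap : Submodule ℂ H) : Set H)
  rw [Submodule.dense_iff_topologicalClosure_eq_top, Submodule.topologicalClosure_eq_top_iff,
    Submodule.eq_bot_iff]
  intro ξ hξ
  have horth : ∀ (x : A) (ζ : ρ.trivialIsotypic), ⟪ξ, ρ.π x ζ⟫_ℂ = 0 := fun x ζ =>
    Submodule.inner_left_of_mem_orthogonal (LinearMap.mem_range_self ρ.inducedMap (x ⊗ₜ ζ)) hξ
  have hrange : ∀ t, ρ.coefficientFunctional μ ξ (S.ellwoodMap t) = 0 := fun t => by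
    induction t with
    | zero => simp
    | tmul x y =>
      rw [coefficientFunctional_ellwoodMap_tmul]
      exact horth x ⟨_, ρ.integral_u_apply_mem_trivialIsotypic μ _⟩
    | add s t hs ht => rw [map_add, map_add, hs, ht, add_zero]
  have hzero : ∀ F, ρ.coefficientFunctional μ ξ F = 0 := fun F =>
    congrFun (hS.equalizer (ρ.coefficientFunctional μ ξ).continuous continuous_const
      (funext hrange)) F
  have hcont : Continuous fun g => ⟪(ρ.u g : H →L[ℂ] H) ξ, ξ⟫_ℂ :=
    (ρ.continuous_u ξ).inner continuous_const
  -- the coefficient function of `ξ`, times the unit of `A`, turns `hzero` into an `L²` norm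
  have hsq : ∫ g, ‖⟪(ρ.u g : H →L[ℂ] H) ξ, ξ⟫_ℂ‖ ^ 2 ∂μ = 0 := by
    have h := hzero ⟨fun g => ⟪(ρ.u g : H →L[ℂ] H) ξ, ξ⟫_ℂ • (1 : A), hcont.smul continuous_const⟩
    rw [coefficientFunctional_apply] at h
    have hF : ∀ g, ⟪ξ, ρ.π (⟪(ρ.u g : H →L[ℂ] H) ξ, ξ⟫_ℂ • (1 : A)) ((ρ.u g : H →L[ℂ] H) ξ)⟫_ℂ =
        ((‖⟪(ρ.u g : H →L[ℂ] H) ξ, ξ⟫_ℂ‖ ^ 2 : ℝ) : ℂ) := fun g => by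
      rw [map_smul, map_one, _root_.smul_apply, one_apply_eq_self,
        inner_smul_right, ← inner_conj_symm ξ, RCLike.mul_conj]
      norm_cast
    simp only [ContinuousMap.coe_mk, hF] at h
    rw [integral_complex_ofReal] at h
    exact_mod_cast h
  by_contra hne
  have hpos := (hcont.norm.pow 2).integral_pos_of_hasCompactSupport_nonneg_nonzero (μ := μ) (x := 1)
    (HasCompactSupport.of_compactSpace _) (fun g => sq_nonneg _) (by simpa using hne)
  exact hpos.ne' hsq

/-! ### Extending an intertwiner from the fixed vectors -/

/-- Exchanging `H₁(1)` for `H₂(1)` along a unitary that intertwines the representations of the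
fixed point algebra does not change the inner products of the induced vectors. -/
lemma inner_inducedMap_lTensor (ρ₁ : S.CovariantRep H₁) (ρ₂ : S.CovariantRep H₂)
    (W : ρ₁.trivialIsotypic ≃ₗᵢ[ℂ] ρ₂.trivialIsotypic)
    (hW : ∀ b ξ, W (ρ₁.trivialIsotypicRep b ξ) = ρ₂.trivialIsotypicRep b (W ξ))
    (s t : A ⊗[ℂ] ρ₁.trivialIsotypic) :
    ⟪ρ₂.inducedMap (W.toLinearEquiv.lTensor A s), ρ₂.inducedMap (W.toLinearEquiv.lTensor A t)⟫_ℂ =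
      ⟪ρ₁.inducedMap s, ρ₁.inducedMap t⟫_ℂ := by
  let _ : MeasurableSpace G := borel G
  have : BorelSpace G := ⟨rfl⟩
  have := isProbabilityMeasure_haarMeasure_top G
  induction s with
  | zero => simp
  | add s s' hs hs' => simp only [map_add, inner_add_left, hs, hs']
  | tmul x ξ =>
    induction t with
    | zero => simp
    | add t t' ht ht' => simp only [map_add, inner_add_right, ht, ht']
    | tmul y η =>
      simp only [LinearEquiv.lTensor_tmul, inducedMap_tmul, LinearIsometryEquiv.coe_toLinearEquiv]
      rw [inner_π_apply_π_apply (haarMeasure ⊤), inner_π_apply_π_apply (haarMeasure ⊤), ← hW,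
        W.inner_map_map]

theorem unitarilyEquivalent_of_trivialIsotypicRep (hS : S.IsFree) (ρ₁ : S.CovariantRep H₁)
    (ρ₂ : S.CovariantRep H₂)
    (h : StarRepUnitarilyEquivalent ρ₁.trivialIsotypicRep ρ₂.trivialIsotypicRep) :
    ρ₁.UnitarilyEquivalent ρ₂ := by
  obtain ⟨W, hW⟩ := h
  let f := W.toLinearEquiv.lTensor A
  let U := f.extendOfIsometry ρ₁.inducedMap ρ₂.inducedMap
    (ρ₁.denseRange_inducedMap hS) (ρ₂.denseRange_inducedMap hS) fun t => by
      rw [norm_eq_sqrt_re_inner (𝕜 := ℂ), ρ₁.inner_inducedMap_lTensor ρ₂ W hW,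
        ← norm_eq_sqrt_re_inner]
  have hU : ∀ t, U (ρ₁.inducedMap t) = ρ₂.inducedMap (f t) :=
    LinearEquiv.extendOfIsometry_eq _ _ _ _ _ _
  have hcomm : ∀ (T : A →ₗ[ℂ] A) t, f (T.rTensor _ t) = T.rTensor _ (f t) := fun T t => by
    induction t with
    | zero => simp
    | tmul y ξ => simp [f]
    | add s t hs ht => rw [map_add, map_add, map_add, map_add, hs, ht]
  refine ⟨U, fun x ξ => ?_, fun g ξ => ?_⟩
  · refine (ρ₁.denseRange_inducedMap hS).induction_on ξ (isClosed_eq (by fun_prop) (by fun_prop))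
      fun t => ?_
    rw [← inducedMap_rTensor_mulLeft, hU, hU, hcomm, inducedMap_rTensor_mulLeft]
  · refine (ρ₁.denseRange_inducedMap hS).induction_on ξ (isClosed_eq (by fun_prop) (by fun_prop))
      fun t => ?_
    rw [← inducedMap_rTensor_α, hU, hU, hcomm, inducedMap_rTensor_α]

end CStarDynamicalSystem.CovariantRep

theorem mainTheorem12 {A G : Type*} [CStarAlgebra A]
    [Group G] [TopologicalSpace G] [IsTopologicalGroup G] [CompactSpace G]
    (S : CStarDynamicalSystem A G) (hS : S.IsFree)
    {HB : Type*} [NormedAddCommGroup HB] [InnerProductSpace ℂ HB] [CompleteSpace HB]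
    (πB : S.fixedPointAlgebra →⋆ₐ[ℂ] (HB →L[ℂ] HB))
    {H₁ : Type*} [NormedAddCommGroup H₁] [InnerProductSpace ℂ H₁] [CompleteSpace H₁]
    {H₂ : Type*} [NormedAddCommGroup H₂] [InnerProductSpace ℂ H₂] [CompleteSpace H₂]
    (ρ₁ : S.CovariantRep H₁) (ρ₂ : S.CovariantRep H₂)
    (hρ₁ : ρ₁.IsFaithful) (hρ₂ : ρ₂.IsFaithful)
    (h₁ : StarRepUnitarilyEquivalent ρ₁.trivialIsotypicRep πB)
    (h₂ : StarRepUnitarilyEquivalent ρ₂.trivialIsotypicRep πB) :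
    ρ₁.UnitarilyEquivalent ρ₂ := by
  obtain ⟨W₁, hW₁⟩ := h₁
  obtain ⟨W₂, hW₂⟩ := h₂
  refine ρ₁.unitarilyEquivalent_of_trivialIsotypicRep hS ρ₂ ⟨W₁.trans W₂.symm, fun b ξ => ?_⟩
  apply W₂.injective
  simp [hW₁, hW₂]
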